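/- Let $d \ge 2$ and $k \ge 1$ be integers. Put $V=\{x\in\mathbb{R}^{d+1} : x_1+\dots+x_{d+1}=0\}$ and $\widetilde w_i = e_i-\frac{1}{d+1}\sum_{j} e_j \in V$, with indices read modulo $d+1$. The hyperplanes $\{x_j-x_i=m\}$ ($1\le i<j\le d+1$, $m\in\mathbb{Z}$) cut $V$ into simplices, which form an infinite simplicial complex $\widetilde{\mathcal C}_d$; its vertices are the elements of the lattice $\widetilde{\mathcal L}=\{x\in V : x_j-x_i\in\mathbb{Z}\text{ for all } i,j\}$, which is spanned over $\mathbb{Z}$ by $\widetilde w_1,\dots,\widetilde w_{d+1}$. Let $M_k$ be the $(d+1)\times(d+1)$ integer matrix whose $i$-th row has the entry $k+1$ in column $i$, the entry $-k$ in column $i+1$ (cyclically), and zeros elsewhere. Let $\widetilde{\mathcal L}_k$ be the sublattice of all $\sum_i a_i\widetilde w_i$ with $(a_1,\dots,a_{d+1})=(b_1,\dots,b_{d+1})M_k$ for some $b_1,\dots,b_{d+1}\in\mathbb{Z}$. Let $T_{(k,\dots,k)}=\widetilde{\mathcal C}_d/\widetilde{\mathcal L}_k$ be the simplicial complex whose faces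 are the classes of faces of $\widetilde{\mathcal C}_d$ up to translation by vectors of $\widetilde{\mathcal L}_k$; one class is contained in another if some representative of the first is contained in some representative of the second. An automorphism of $T_{(k,\dots,k)}$ is a bijection of its set of faces that preserves containment in both directions. Then the automorphism group of $T_{(k,\dots,k)}$ is generated by the translations induced by $x\mapsto x+v$ with $v\in\widetilde{\mathcal L}$, the sign reversal $R$ induced by $x\mapsto -x$, and the cyclic shift induced by the linear map $\widetilde w_i\mapsto\widetilde w_{i+1}$ of $V$, which generates the group $C_{d+1}$. Its order is $2(d+1)\det M_k$. -/

import Mathlib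

namespace HeawoodTorus

noncomputable section

/-- The ambient space `ℝ^{d+1}`; indices live in `Fin (d+1)` and are read cyclically. -/
abbrev Ambient (d : ℕ) : Type := Fin (d + 1) → ℝ

/-- The hyperplane `V = {x : x₁ + ⋯ + x_{d+1} = 0}`. -/
def hyperplaneV (d : ℕ) : Set (Ambient d) := {x | ∑ i, x i = 0}

/-- The closed cell, containing `x` in its relative interior, of the affine Coxeter arrangement
`{x_j - x_i = m}` (`i ≠ j`, `m ∈ ℤ`) restricted to `V`: the points of `V` that lie weakly on the
same side as `x` of every hyperplane of the arrangement (and on every hyperplane through `x`). -/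
def closedCell {d : ℕ} (x : Ambient d) : Set (Ambient d) :=
  {y | y ∈ hyperplaneV d ∧ ∀ (i j : Fin (d + 1)) (m : ℤ),
    (x j - x i ≤ (m : ℝ) → y j - y i ≤ (m : ℝ)) ∧ ((m : ℝ) ≤ x j - x i → (m : ℝ) ≤ y j - y i)}

/-- The weight lattice of type `A_d`: the points of `V` with integral coordinate differences.
These are the vertices (zero-dimensional cells) of the affine Coxeter arrangement. -/
def weightLattice (d : ℕ) : AddSubgroup (Ambient d) where
  carrier := {x | x ∈ hyperplaneV d ∧ ∀ i j : Fin (d + 1), ∃ m : ℤ, x j - x i = (m : ℝ)}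
  zero_mem' := ⟨by simp [hyperplaneV], fun _ _ => ⟨0, by simp⟩⟩
  add_mem' := by
    rintro x y ⟨hx, hx'⟩ ⟨hy, hy'⟩
    refine ⟨?_, fun i j => ?_⟩
    · simp only [hyperplaneV, Set.mem_ofPred_eq] at *
      simp [Finset.sum_add_distrib, hx, hy]
    · obtain ⟨a, ha⟩ := hx' i j
      obtain ⟨b, hb⟩ := hy' i j
      exact ⟨a + b, by push_cast; simp only [Pi.add_apply]; linarith⟩
  neg_mem' := by
    rintro x ⟨hx, hx'⟩
    refine ⟨?_, fun i j => ?_⟩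
    · simp only [hyperplaneV, Set.mem_ofPred_eq] at *
      simp [hx]
    · obtain ⟨a, ha⟩ := hx' i j
      exact ⟨-a, by push_cast; simp only [Pi.neg_apply]; linarith⟩

/-- The faces of the infinite simplicial complex cut out in `V` by the affine Coxeter arrangement.
A face is recorded by its vertex set, the set of lattice points of a closed cell. -/
def IsFace {d : ℕ} (F : Set (Ambient d)) : Prop :=
  ∃ x ∈ hyperplaneV d, F = closedCell x ∩ (weightLattice d : Set (Ambient d))

/-- The type of (non-empty) faces of the infinite complex. -/
def Face (d : ℕ) : Type := {F : Set (Ambient d) // IsFace F}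

/-- The vectors `w_i = e_i - (1/(d+1)) (1,…,1)`. -/
def w {d : ℕ} (i : Fin (d + 1)) : Ambient d :=
  fun j => (if j = i then 1 else 0) - 1 / ((d : ℝ) + 1)

/-- The matrix `M_k`: row `i` has `k_i + 1` in column `i`, `-k_{i+1}` in column `i + 1`
(cyclically), and zeros elsewhere. -/
def M {d : ℕ} (k : Fin (d + 1) → ℕ) : Matrix (Fin (d + 1)) (Fin (d + 1)) ℤ :=
  fun i j => (if j = i then (k j : ℤ) + 1 else 0) - (if j = i + 1 then (k j : ℤ) else 0)

/-- The sublattice of all `∑ a_i w_i` with `a = b M_k` for some integer row vector `b`. -/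
def sublattice {d : ℕ} (k : Fin (d + 1) → ℕ) : AddSubgroup (Ambient d) where
  carrier := {v | ∃ b : Fin (d + 1) → ℤ, v = ∑ i, (Matrix.vecMul b (M k) i : ℤ) • w i}
  zero_mem' := ⟨0, by simp⟩
  add_mem' := by
    rintro _ _ ⟨a, rfl⟩ ⟨b, rfl⟩
    exact ⟨a + b, by simp [Matrix.add_vecMul, add_smul, Finset.sum_add_distrib]⟩
  neg_mem' := by
    rintro _ ⟨a, rfl⟩
    exact ⟨-a, by simp [Matrix.neg_vecMul]⟩

/-- Two faces are `k`-equivalent if they differ by a translation by a vector of the sublattice. -/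
def faceSetoid {d : ℕ} (k : Fin (d + 1) → ℕ) : Setoid (Face d) where
  r F F' := ∃ v ∈ sublattice k, F'.1 = (fun x => x + v) '' F.1
  iseqv :=
    { refl := fun F => ⟨0, zero_mem _, by simp⟩
      symm := by
        rintro F F' ⟨v, hv, h⟩
        exact ⟨-v, neg_mem hv, by rw [h, Set.image_image]; simp⟩
      trans := by
        rintro F F' F'' ⟨v, hv, h⟩ ⟨u, hu, h'⟩
        exact ⟨v + u, add_mem hv hu, by rw [h', h, Set.image_image]; simp [add_assoc]⟩ }

/-- The quotient complex `T_k`, given by its face classes. -/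
def Torus {d : ℕ} (k : Fin (d + 1) → ℕ) : Type := Quotient (faceSetoid k)

/-- The class of a face in `T_k`. -/
def Torus.mk {d : ℕ} (k : Fin (d + 1) → ℕ) (F : Face d) : Torus k := Quotient.mk (faceSetoid k) F

/-- A face class is contained in another if some representative of the first is contained in
some representative of the second. -/
instance {d : ℕ} (k : Fin (d + 1) → ℕ) : LE (Torus k) where
  le a b := ∃ F F' : Face d, Torus.mk k F = a ∧ Torus.mk k F' = b ∧ F.1 ⊆ F'.1

/-- The automorphism group of `T_k`: the bijections of its set of faces that preserve and reflect
incidence (containment); the group law is composition. -/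
abbrev TorusAut {d : ℕ} (k : Fin (d + 1) → ℕ) : Type := Torus k ≃o Torus k

/-- The map induced on `T_k` by a bijection of the ambient space that maps faces to faces and
conjugates translations by the sublattice to translations by the sublattice. -/
def inducedMap {d : ℕ} (k : Fin (d + 1) → ℕ) (g : Ambient d ≃ Ambient d)
    (hF : ∀ F, IsFace F → IsFace (g '' F))
    (hL : ∀ v ∈ sublattice k, ∃ v' ∈ sublattice k, ∀ x, g (x + v) = g x + v') :
    Torus k → Torus k :=
  Quotient.lift (fun F : Face d => Torus.mk k ⟨g '' F.1, hF F.1 F.2⟩) (by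
    rintro F F' ⟨v, hv, h⟩
    obtain ⟨v', hv', hg⟩ := hL v hv
    refine Quotient.sound ⟨v', hv', ?_⟩
    simp only [h, Set.image_image, hg])

/-- The automorphism of `T_k` induced by a symmetry of the infinite complex that normalizes the
group of translations by the sublattice. -/
def inducedAut {d : ℕ} (k : Fin (d + 1) → ℕ) (g : Ambient d ≃ Ambient d)
    (hF : ∀ F, IsFace F → IsFace (g '' F)) (hF' : ∀ F, IsFace F → IsFace (g.symm '' F))
    (hL : ∀ v ∈ sublattice k, ∃ v' ∈ sublattice k, ∀ x, g (x + v) = g x + v')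
    (hL' : ∀ v ∈ sublattice k, ∃ v' ∈ sublattice k, ∀ x, g.symm (x + v) = g.symm x + v') :
    TorusAut k where
  toFun := inducedMap k g hF hL
  invFun := inducedMap k g.symm hF' hL'
  left_inv := by
    rintro ⟨F⟩
    refine congrArg (Torus.mk k) (Subtype.ext ?_)
    simp [Set.image_image]
  right_inv := by
    rintro ⟨F⟩
    refine congrArg (Torus.mk k) (Subtype.ext ?_)
    simp [Set.image_image]
  map_rel_iff' := by
    intro a b
    constructor
    · rintro ⟨F, F', ha, hb, h⟩
      refine ⟨⟨g.symm '' F.1, hF' _ F.2⟩, ⟨g.symm '' F'.1, hF' _ F'.2⟩, ?_, ?_,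
        Set.image_mono h⟩
      · have := congrArg (inducedMap k g.symm hF' hL') ha
        refine this.trans ?_
        obtain ⟨A⟩ := a
        refine congrArg (Torus.mk k) (Subtype.ext ?_)
        simp [Set.image_image]
      · have := congrArg (inducedMap k g.symm hF' hL') hb
        refine this.trans ?_
        obtain ⟨B⟩ := b
        refine congrArg (Torus.mk k) (Subtype.ext ?_)
        simp [Set.image_image]
    · rintro ⟨F, F', rfl, rfl, h⟩
      exact ⟨⟨g '' F.1, hF _ F.2⟩, ⟨g '' F'.1, hF _ F'.2⟩, rfl, rfl, Set.image_mono h⟩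

theorem isFace_translate {d : ℕ} {v : Ambient d} (hv : v ∈ weightLattice d) (F : Set (Ambient d))
    (hF : IsFace F) : IsFace (Equiv.addRight v '' F) := by
  obtain ⟨x, hx, rfl⟩ := hF
  obtain ⟨hv0, hvm⟩ := id hv
  have hx0 : ∑ i, x i = 0 := hx
  have hv0' : ∑ i, v i = 0 := hv0
  refine ⟨x + v, ?_, ?_⟩
  · simp [hyperplaneV, Finset.sum_add_distrib, hx0, hv0']
  ext y
  rw [Equiv.image_eq_preimage_symm]
  simp only [Set.mem_preimage, Set.mem_inter_iff, SetLike.mem_coe,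
    Equiv.addRight_symm, Equiv.coe_addRight]
  refine and_congr ?_ ?_
  · simp only [closedCell, hyperplaneV, Set.mem_ofPred_eq, Pi.add_apply, Pi.neg_apply,
      Finset.sum_add_distrib, Finset.sum_neg_distrib, hv0', neg_zero, add_zero]
    refine and_congr Iff.rfl (forall_congr' fun i => forall_congr' fun j => ?_)
    obtain ⟨n, hn⟩ := hvm i j
    constructor
    · intro h m
      have := h (m - n)
      push_cast at this
      exact ⟨fun h' => by linarith [this.1 (by linarith)],
        fun h' => by linarith [this.2 (by linarith)]⟩
    · intro h m
      have := h (m + n)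
      push_cast at this
      exact ⟨fun h' => by linarith [this.1 (by linarith)],
        fun h' => by linarith [this.2 (by linarith)]⟩
  · exact ⟨fun h => by simpa using add_mem h hv, fun h => add_mem h (neg_mem hv)⟩

/-- The automorphism of `T_k` induced by the translation by a vector of the weight lattice. -/
def translation {d : ℕ} (k : Fin (d + 1) → ℕ) (v : weightLattice d) : TorusAut k :=
  inducedAut k (Equiv.addRight (v : Ambient d)) (isFace_translate v.2)
    (by simpa using isFace_translate (neg_mem v.2))
    (fun u hu => ⟨u, hu, fun x => by simp [add_right_comm]⟩)
    (fun u hu => ⟨u, hu, fun x => by simp [add_right_comm]⟩)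

/-- The set `T` of translations of `T_k`. -/
def translations {d : ℕ} (k : Fin (d + 1) → ℕ) : Set (TorusAut k) := Set.range (translation k)

theorem isFace_neg {d : ℕ} (F : Set (Ambient d)) (hF : IsFace F) :
    IsFace (Equiv.neg (Ambient d) '' F) := by
  obtain ⟨x, hx, rfl⟩ := hF
  have hx0 : ∑ i, x i = 0 := hx
  refine ⟨-x, by simp [hyperplaneV, hx0], ?_⟩
  ext y
  rw [Equiv.image_eq_preimage_symm]
  simp only [Set.mem_preimage, Set.mem_inter_iff, SetLike.mem_coe,
    Equiv.neg_symm, Equiv.neg_apply]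
  refine and_congr ?_ neg_mem_iff
  simp only [closedCell, hyperplaneV, Set.mem_ofPred_eq, Pi.neg_apply, Finset.sum_neg_distrib,
    neg_eq_zero]
  refine and_congr Iff.rfl (forall_congr' fun i => forall_congr' fun j => ?_)
  constructor
  · intro h m
    have := h (-m)
    push_cast at this
    exact ⟨fun h' => by linarith [this.2 (by linarith)],
      fun h' => by linarith [this.1 (by linarith)]⟩
  · intro h m
    have := h (-m)
    push_cast at this
    exact ⟨fun h' => by linarith [this.2 (by linarith)],
      fun h' => by linarith [this.1 (by linarith)]⟩

/-- The sign reversal `R` of `T_k`, induced by `x ↦ -x`, that is, by `w_i ↦ -w_i`. -/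
def signReversal {d : ℕ} (k : Fin (d + 1) → ℕ) : TorusAut k :=
  inducedAut k (Equiv.neg (Ambient d)) isFace_neg (by simpa using isFace_neg)
    (fun v hv => ⟨-v, neg_mem hv, fun x => by simp [add_comm]⟩)
    (fun v hv => ⟨-v, neg_mem hv, fun x => by simp [add_comm]⟩)

/-- The linear map permuting the coordinates along `s`; it sends `w i` to `w (s i)`. -/
def permCoords {d : ℕ} (s : Equiv.Perm (Fin (d + 1))) : Ambient d ≃ Ambient d :=
  s.arrowCongr (Equiv.refl ℝ)

theorem permCoords_apply {d : ℕ} (s : Equiv.Perm (Fin (d + 1))) (x : Ambient d)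
    (i : Fin (d + 1)) : permCoords s x i = x (s.symm i) := rfl

theorem permCoords_symm {d : ℕ} (s : Equiv.Perm (Fin (d + 1))) :
    (permCoords s).symm = permCoords s.symm := rfl

theorem permCoords_w {d : ℕ} (s : Equiv.Perm (Fin (d + 1))) (i : Fin (d + 1)) :
    permCoords s (w i) = w (s i) := by
  ext j
  simp [permCoords_apply, w, Equiv.symm_apply_eq]

theorem isFace_permCoords {d : ℕ} (s : Equiv.Perm (Fin (d + 1))) (F : Set (Ambient d))
    (hF : IsFace F) : IsFace (permCoords s '' F) := by
  obtain ⟨x, hx, rfl⟩ := hF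
  have hsum : ∀ (t : Equiv.Perm (Fin (d + 1))) (y : Ambient d), ∑ i, y (t i) = ∑ i, y i :=
    fun t y => Equiv.sum_comp t y
  have hx0 : ∑ i, x i = 0 := hx
  refine ⟨permCoords s x, by simp [hyperplaneV, permCoords_apply, hsum, hx0], ?_⟩
  ext y
  rw [Equiv.image_eq_preimage_symm]
  simp only [Set.mem_preimage, Set.mem_inter_iff, SetLike.mem_coe, permCoords_symm]
  refine and_congr ?_ ?_
  · simp only [closedCell, hyperplaneV, Set.mem_ofPred_eq, permCoords_apply, Equiv.symm_symm, hsum]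
    refine and_congr Iff.rfl ⟨fun h i j m => ?_, fun h i j m => ?_⟩
    · simpa using h (s.symm i) (s.symm j) m
    · simpa using h (s i) (s j) m
  · change (_ ∧ _) ↔ (_ ∧ _)
    simp only [hyperplaneV, Set.mem_ofPred_eq, permCoords_apply, Equiv.symm_symm, hsum]
    refine and_congr Iff.rfl ⟨fun h i j => ?_, fun h i j => h (s i) (s j)⟩
    simpa using h (s.symm i) (s.symm j)

/-- For constant `k`, powers of the cyclic shift preserve the sublattice. -/
theorem permCoords_sublattice {d : ℕ} (k : ℕ) (c : Fin (d + 1)) (v : Ambient d)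
    (hv : v ∈ sublattice (fun _ : Fin (d + 1) => k)) :
    ∃ v' ∈ sublattice (fun _ : Fin (d + 1) => k),
      ∀ x, permCoords (Equiv.addRight c) (x + v) = permCoords (Equiv.addRight c) x + v' := by
  refine ⟨permCoords (Equiv.addRight c) v, ?_, fun x => rfl⟩
  obtain ⟨b, rfl⟩ := hv
  refine ⟨fun i => b (i - c), ?_⟩
  have h1 : ∀ a : Fin (d + 1) → ℤ, permCoords (Equiv.addRight c) (∑ i, a i • w i) =
      ∑ i, a i • w (i + c) := by
    intro a
    ext j
    rw [permCoords_apply, Finset.sum_apply, Finset.sum_apply]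
    refine Finset.sum_congr rfl fun i _ => ?_
    have := congrFun (permCoords_w (Equiv.addRight c) i) j
    rw [permCoords_apply] at this
    simp only [Pi.smul_apply, this, Equiv.coe_addRight]
  rw [h1, ← Equiv.sum_comp (Equiv.addRight c)
    (fun i => (Matrix.vecMul (fun i => b (i - c)) (M fun _ => k) i : ℤ) • w i)]
  refine Finset.sum_congr rfl fun i _ => ?_
  rw [Equiv.coe_addRight]
  congr 1
  simp only [Matrix.vecMul, dotProduct]
  refine Eq.trans ?_ (Equiv.sum_comp (Equiv.addRight c) _)
  refine Finset.sum_congr rfl fun j _ => ?_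
  simp only [Equiv.coe_addRight, add_sub_cancel_right, M, add_left_inj, add_right_comm j c 1]

/-- The cyclic shift of `T_{(k,…,k)}`, induced by the linear map `w_i ↦ w_{i+1}` (indices modulo
`d + 1`); it generates the cyclic group `C_{d+1}`. -/
def cyclicShift (d k : ℕ) : TorusAut (fun _ : Fin (d + 1) => k) :=
  inducedAut (fun _ => k) (permCoords (Equiv.addRight 1))
    (isFace_permCoords _)
    (by simpa only [permCoords_symm] using isFace_permCoords _)
    (permCoords_sublattice k 1)
    (by simpa [permCoords_symm] using permCoords_sublattice k (-1))

end

end HeawoodTorus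

namespace HeawoodTorus

/-! ### The period lattice in integer coordinates -/

/-! Since the `w i` sum to zero, lattice points are integer vectors modulo constants. Constants lie
in the row span of `M_k`, so the vertices of the torus form the group `ℤ^{d+1} / periods`, of order
`det M_k`. Lattice points share a cell exactly when their difference oscillates by at most one, that
is, when they differ by `ind A` plus a constant. Hence the neighbours of a vertex correspond to the
proper nonempty index sets, and two neighbours lie in a common face with it exactly when their sets
are comparable. The quotient does not blur this picture, because nonconstant periods oscillate by at
least 3 (`eq_const_of_mem_periods`).

An automorphism therefore induces a comparability automorphism of the Boolean lattice on `d + 1 ≥ 3`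
elements, and such a map is a permutation, possibly followed by complementation
(`IsComparabilityMap.exists_perm`). A translation brings the image of the origin back to the origin,
and `R` accounts for complementation, since `-ind A` and `ind Aᶜ` differ by a constant. What remains
acts on the star of the origin by a permutation `p` of the coordinates. Neighbouring stars overlap
enough to force the same `p` everywhere (`map_vert_of_star_zero`). Then `p` preserves the periods,
which makes it a cyclic shift (`apply_add_one_of_map_periods`).

Every automorphism is thus a translation times a shift times an optional sign reversal. This
decomposition is unique modulo the periods, which gives the order. -/

/-- The row span of `M_k` in `ℤ^{d+1}`. -/
def periods (d k : ℕ) : Submodule ℤ (Fin (d + 1) → ℤ) :=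
  LinearMap.range (Matrix.vecMulLinear (M fun _ : Fin (d + 1) => k))

theorem mem_periods {d k : ℕ} {s : Fin (d + 1) → ℤ} :
    s ∈ periods d k ↔ ∃ b, Matrix.vecMul b (M fun _ : Fin (d + 1) => k) = s := Iff.rfl

theorem vecMul_M {d : ℕ} (k : ℕ) (b : Fin (d + 1) → ℤ) (j : Fin (d + 1)) :
    Matrix.vecMul b (M fun _ => k) j = (k + 1) * b j - k * b (j - 1) := by
  have h : ∀ i, (j = i + 1 ↔ j - 1 = i) := fun i => by rw [sub_eq_iff_eq_add]
  simp only [Matrix.vecMul, dotProduct, M, mul_sub, Finset.sum_sub_distrib, mul_ite, mul_zero, h,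
    Finset.sum_ite_eq, Finset.mem_univ, if_true]
  ring

open Fin.NatCast Fin.CommRing in
theorem forall_of_forall_sub_one {d : ℕ} {P : Fin (d + 1) → Prop} {j₀ : Fin (d + 1)}
    (h₀ : P j₀) (h : ∀ j, P j → P (j - 1)) (j : Fin (d + 1)) : P j := by
  have key : ∀ m : ℕ, P (j₀ - (m : Fin (d + 1))) := by
    intro m
    induction m with
    | zero => simpa using h₀
    | succ m ih => simpa [sub_sub] using h _ ih
  simpa using key (j₀ - j).val

theorem const_mem_periods {d k : ℕ} (c : ℤ) : (fun _ => c) ∈ periods d k :=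
  ⟨fun _ => c, by ext j; rw [Matrix.vecMulLinear_apply, vecMul_M]; ring⟩

/-- Nonconstant periods oscillate by at least `3`. -/
theorem eq_const_of_mem_periods {d k : ℕ} (hk : 1 ≤ k) {s : Fin (d + 1) → ℤ}
    (hs : s ∈ periods d k) (h : ∀ i j, s i - s j ≤ 2) : ∃ c, s = fun _ => c := by
  obtain ⟨b, rfl⟩ := mem_periods.1 hs
  obtain ⟨p, hp⟩ := Finite.exists_max b
  obtain ⟨q, hq⟩ := Finite.exists_min b
  by_cases hpq : b p = b q
  · have hb : ∀ j, b j = b p := fun j => le_antisymm (hp j) (hpq ▸ hq j)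
    exact ⟨b p, by ext j; rw [vecMul_M, hb j, hb (j - 1)]; ring⟩
  · have hlt : b q < b p := lt_of_le_of_ne (hq p) (Ne.symm hpq)
    -- Where `b` has just risen to its maximum, `s i ≥ b p + k`; where it has just fallen to its
    -- minimum, `s j ≤ b q - k`. The gap is at least `2 * k + 1 ≥ 3`.
    obtain ⟨i, hi, hi'⟩ : ∃ i, b i = b p ∧ b (i - 1) < b p := by
      by_contra! hc
      have := forall_of_forall_sub_one (P := fun j => b j = b p) rfl
        (fun j hj => le_antisymm (hp _) (hc j hj)) q
      omega
    obtain ⟨j, hj, hj'⟩ : ∃ i, b i = b q ∧ b q < b (i - 1) := by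
      by_contra! hc
      have := forall_of_forall_sub_one (P := fun j => b j = b q) rfl
        (fun j hj => le_antisymm (hc j hj) (hq _)) p
      omega
    have := h i j
    rw [vecMul_M, vecMul_M, hi, hj] at this
    have hk' : (1 : ℤ) ≤ k := by exact_mod_cast hk
    nlinarith [mul_le_mul_of_nonneg_left (Int.add_one_le_of_lt hi') (by omega : (0 : ℤ) ≤ k),
      mul_le_mul_of_nonneg_left (Int.add_one_le_of_lt hj') (by omega : (0 : ℤ) ≤ k)]

/-- Modulo `k` the matrix `M_k` is the identity, so `b M_k ∈ k ℤ^{d+1}` forces `k ∣ b`, and `k` can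
be divided out. -/
theorem mem_periods_of_smul_mem {d k : ℕ} (hk : 1 ≤ k) {u : Fin (d + 1) → ℤ}
    (h : (fun j => (k : ℤ) * u j) ∈ periods d k) : u ∈ periods d k := by
  obtain ⟨b, hb⟩ := mem_periods.1 h
  have hk' : (k : ℤ) ≠ 0 := by exact_mod_cast Nat.one_le_iff_ne_zero.1 hk
  have hdvd : ∀ j, ∃ c, b j = k * c := fun j => by
    have := congrFun hb j
    rw [vecMul_M] at this
    exact ⟨u j - b j + b (j - 1), by linarith⟩
  choose c hc using hdvd
  refine ⟨c, ?_⟩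
  ext j
  have := congrFun hb j
  rw [vecMul_M, hc, hc] at this
  rw [Matrix.vecMulLinear_apply, vecMul_M]
  exact mul_left_cancel₀ hk' (by linarith)

/-- Scale the off-diagonal entries by `t ∈ [0, 1]`. Diagonal dominance keeps the determinant
nonzero, and it is positive at `t = 0`, so by continuity it is positive at `t = 1`. -/
theorem det_M_pos (d k : ℕ) : 0 < (M fun _ : Fin (d + 1) => k).det := by
  let A : ℝ → Matrix (Fin (d + 1)) (Fin (d + 1)) ℝ := fun t i j =>
    (if j = i then (k : ℝ) + 1 else 0) - (if j = i + 1 then t * k else 0)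
  have hA : ∀ t b j, Matrix.vecMul b (A t) j = (k + 1) * b j - t * k * b (j - 1) := by
    intro t b j
    have h : ∀ i, (j = i + 1 ↔ j - 1 = i) := fun i => by rw [sub_eq_iff_eq_add]
    simp only [Matrix.vecMul, dotProduct, A, mul_sub, Finset.sum_sub_distrib, mul_ite, mul_zero, h,
      Finset.sum_ite_eq, Finset.mem_univ, if_true]
    ring
  have hk0 : (0 : ℝ) ≤ k := Nat.cast_nonneg k
  have hne : ∀ t ∈ Set.Icc (0 : ℝ) 1, (A t).det ≠ 0 := by
    intro t ht h0
    obtain ⟨v, hv, hv0⟩ := Matrix.exists_vecMul_eq_zero_iff.2 h0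
    obtain ⟨p, hp⟩ := Finite.exists_max fun j => |v j|
    have h1 := congrFun hv0 p
    rw [hA, Pi.zero_apply, sub_eq_zero] at h1
    have h2 := congrArg abs h1
    rw [abs_mul, abs_mul, abs_mul, abs_of_nonneg ht.1, abs_of_nonneg hk0,
      abs_of_nonneg (by positivity : (0 : ℝ) ≤ k + 1)] at h2
    have h3 : t * k * |v (p - 1)| ≤ k * |v p| := by
      have := mul_le_of_le_one_left hk0 ht.2
      exact mul_le_mul this (hp _) (abs_nonneg _) hk0
    have h4 : |v p| ≤ 0 := by linarith
    exact hv (funext fun j => abs_nonpos_iff.1 ((hp j).trans h4))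
  have hcont : Continuous fun t => (A t).det := by
    refine Continuous.matrix_det (continuous_matrix fun i j => ?_)
    refine continuous_const.sub ?_
    split_ifs <;> fun_prop
  have h0 : 0 < (A 0).det := by
    have : A 0 = Matrix.diagonal fun _ => (k : ℝ) + 1 := by
      ext i j
      simp [A, Matrix.diagonal_apply, eq_comm]
    rw [this, Matrix.det_diagonal]
    positivity
  have h1 : 0 < (A 1).det := by
    by_contra! hc
    obtain ⟨t, ht, h⟩ := intermediate_value_Icc' zero_le_one hcont.continuousOn ⟨hc, h0.le⟩
    exact hne t ht h
  have h2 : A 1 = (M fun _ : Fin (d + 1) => k).map (Int.castRingHom ℝ) := by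
    ext i j
    simp only [A, M, Matrix.map_apply, one_mul]
    split_ifs <;> simp
  rw [h2, ← RingHom.mapMatrix_apply, ← RingHom.map_det] at h1
  simpa using h1

theorem card_quotient_periods (d k : ℕ) :
    (Nat.card ((Fin (d + 1) → ℤ) ⧸ periods d k) : ℤ) = (M fun _ : Fin (d + 1) => k).det := by
  have hdet := det_M_pos d k
  have hinj : Function.Injective (Matrix.vecMulLinear (M fun _ : Fin (d + 1) => k)) := by
    rw [← LinearMap.ker_eq_bot, LinearMap.ker_eq_bot']
    intro v hv
    by_contra h
    exact hdet.ne' (Matrix.exists_vecMul_eq_zero_iff.1 ⟨v, h, hv⟩)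
  let e : (Fin (d + 1) → ℤ) ≃ₗ[ℤ] periods d k := LinearEquiv.ofInjective _ hinj
  rw [← Submodule.natAbs_det_equiv (periods d k) e]
  have : ((periods d k).subtype ∘ₗ AddMonoidHom.toIntLinearMap
      (e : (Fin (d + 1) → ℤ) →+ periods d k)) =
      Matrix.toLin' (M fun _ : Fin (d + 1) => k).transpose := by
    refine LinearMap.ext fun v => ?_
    rw [Matrix.toLin'_apply, Matrix.mulVec_transpose]
    rfl
  rw [this, LinearMap.det_toLin', Matrix.det_transpose, Int.natAbs_of_nonneg hdet.le]

/-! ### Comparability automorphisms of Boolean lattices -/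

section Boolean

variable {α : Type*} [Fintype α] [DecidableEq α]

/-- The number of sets comparable with `A` is invariant under comparability maps. It determines the
size of `A` up to passing to the complementary size. -/
theorem card_comparable (A : Finset α) :
    (Finset.univ.filter fun B => A ⊆ B ∨ B ⊆ A).card + 1 =
      2 ^ A.card + 2 ^ (Fintype.card α - A.card) := by
  have h : (Finset.univ.filter fun B => A ⊆ B ∨ B ⊆ A) =
      Finset.Icc A Finset.univ ∪ Finset.Icc ∅ A := by
    ext B; simp
  have h' : Finset.Icc A Finset.univ ∩ Finset.Icc ∅ A = {A} := by
    ext B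
    simp only [Finset.mem_inter, Finset.mem_Icc, Finset.mem_singleton]
    exact ⟨fun h => le_antisymm h.2.2 h.1.1, by rintro rfl; simp⟩
  have := Finset.card_union_add_card_inter (Finset.Icc A Finset.univ) (Finset.Icc ∅ A)
  rw [h', Finset.card_Icc_finset (Finset.subset_univ _),
    Finset.card_Icc_finset (Finset.empty_subset _), Finset.card_singleton] at this
  rw [h, this, Finset.card_univ]
  simp [add_comm]

/-- The pairs `2 ^ a, 2 ^ (n - a)` and `2 ^ b, 2 ^ (n - b)` have equal sums and equal products `2 ^
n`, so they agree up to order. -/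
theorem eq_or_add_eq_of_two_pow_add_two_pow {a b n : ℕ} (ha : a ≤ n) (hb : b ≤ n)
    (h : 2 ^ a + 2 ^ (n - a) = 2 ^ b + 2 ^ (n - b)) : a = b ∨ a + b = n := by
  have h1 : (2 : ℤ) ^ a * 2 ^ (n - a) = 2 ^ n := by rw [← pow_add]; congr 1; omega
  have h2 : (2 : ℤ) ^ b * 2 ^ (n - b) = 2 ^ n := by rw [← pow_add]; congr 1; omega
  have h3 : (2 : ℤ) ^ a + 2 ^ (n - a) = 2 ^ b + 2 ^ (n - b) := by exact_mod_cast h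
  have h4 : ((2 : ℤ) ^ a - 2 ^ b) * (2 ^ a - 2 ^ (n - b)) = 0 := by
    linear_combination (2 : ℤ) ^ a * h3 - h1 + h2
  have inj : ∀ {x y : ℕ}, (2 : ℤ) ^ x - 2 ^ y = 0 → x = y := fun {x y} hxy =>
    Nat.pow_right_injective le_rfl (by exact_mod_cast sub_eq_zero.1 hxy)
  rcases mul_eq_zero.1 h4 with h5 | h5
  · exact Or.inl (inj h5)
  · exact Or.inr (by have := inj h5; omega)

/-- Self-maps of the Boolean lattice that fix the extreme elements and preserve and reflect
comparability. -/
structure IsComparabilityMap (h : Finset α → Finset α) : Prop where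
  injective : Function.Injective h
  map_empty : h ∅ = ∅
  map_univ : h Finset.univ = Finset.univ
  comparable_iff : ∀ A B, (h A ⊆ h B ∨ h B ⊆ h A) ↔ (A ⊆ B ∨ B ⊆ A)

omit [Fintype α] [DecidableEq α] in
theorem singleton_comparable_iff {a : α} {A : Finset α} (hA : A.Nonempty) :
    ({a} ⊆ A ∨ A ⊆ {a}) ↔ a ∈ A := by
  rw [Finset.singleton_subset_iff]
  refine ⟨?_, Or.inl⟩
  rintro (h | h)
  · exact h
  · rw [hA.subset_singleton_iff.1 h]; simp

theorem compl_comparable_iff {A B : Finset α} : (Aᶜ ⊆ Bᶜ ∨ Bᶜ ⊆ Aᶜ) ↔ (A ⊆ B ∨ B ⊆ A) := by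
  rw [Finset.compl_subset_compl, Finset.compl_subset_compl, or_comm]

omit [DecidableEq α] in
theorem IsComparabilityMap.nonempty {h : Finset α → Finset α} (hh : IsComparabilityMap h)
    {A : Finset α} (hA : A.Nonempty) : (h A).Nonempty := by
  rw [Finset.nonempty_iff_ne_empty, ← hh.map_empty]
  exact fun h' => hA.ne_empty (hh.injective h')

omit [DecidableEq α] in
theorem IsComparabilityMap.ne_univ {h : Finset α → Finset α} (hh : IsComparabilityMap h)
    {A : Finset α} (hA : A ≠ Finset.univ) : h A ≠ Finset.univ := by
  rw [← hh.map_univ]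
  exact fun h' => hA (hh.injective h')

theorem IsComparabilityMap.card_eq_or {h : Finset α → Finset α} (hh : IsComparabilityMap h)
    (A : Finset α) : (h A).card = A.card ∨ (h A).card + A.card = Fintype.card α := by
  refine eq_or_add_eq_of_two_pow_add_two_pow (Finset.card_le_univ _) (Finset.card_le_univ _) ?_
  rw [← card_comparable, ← card_comparable]
  congr 1
  have hbij := Finite.injective_iff_bijective.1 hh.injective
  symm
  refine Finset.card_bij (fun B _ => h B) ?_ (fun _ _ _ _ e => hh.injective e) ?_
  · intro B hB
    simpa [hh.comparable_iff] using hB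
  · intro B hB
    obtain ⟨C, rfl⟩ := hbij.2 B
    exact ⟨C, by simpa [hh.comparable_iff] using hB, rfl⟩

omit [DecidableEq α] in
/-- A comparability-preserving map given on singletons by `i ↦ {p i}` is induced by a
permutation. -/
theorem exists_perm_of_map_singleton {h : Finset α → Finset α} (hinj : Function.Injective h)
    (hne : ∀ A : Finset α, A.Nonempty → A ≠ Finset.univ → (h A).Nonempty)
    (hcomp : ∀ A B : Finset α, A.Nonempty → A ≠ Finset.univ → B.Nonempty → B ≠ Finset.univ →
      ((h A ⊆ h B ∨ h B ⊆ h A) ↔ (A ⊆ B ∨ B ⊆ A)))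
    (hcard : 2 ≤ Fintype.card α) (hsing : ∀ i, ∃ j, h {i} = {j}) :
    ∃ p : Equiv.Perm α, ∀ A : Finset α, A.Nonempty → A ≠ Finset.univ →
      h A = A.map p.toEmbedding := by
  choose p hp using hsing
  have hpinj : Function.Injective p := fun i j hij =>
    Finset.singleton_injective (hinj (by rw [hp, hp, hij]))
  refine ⟨Equiv.ofBijective p (Finite.injective_iff_bijective.1 hpinj), fun A hA hA' => ?_⟩
  have huniv : ∀ i : α, {i} ≠ (Finset.univ : Finset α) := fun i hi => by
    have := congrArg Finset.card hi
    rw [Finset.card_singleton, Finset.card_univ] at this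
    omega
  ext j
  obtain ⟨i, rfl⟩ := (Finite.injective_iff_bijective.1 hpinj).2 j
  have := hcomp {i} A (Finset.singleton_nonempty i) (huniv i) hA hA'
  rw [hp, singleton_comparable_iff (hne A hA hA'), singleton_comparable_iff hA] at this
  rw [this]
  simp

/-- Comparability maps of the Boolean lattice are induced by permutations, up to complements. -/
theorem IsComparabilityMap.exists_perm {h : Finset α → Finset α} (hh : IsComparabilityMap h)
    (hcard : 3 ≤ Fintype.card α) :
    ∃ p : Equiv.Perm α, (∀ A, h A = A.map p.toEmbedding) ∨
      ∀ A : Finset α, A.Nonempty → A ≠ Finset.univ → h A = (A.map p.toEmbedding)ᶜ := by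
  have hS : ∀ i, (∃ a, h {i} = {a}) ∨ ∃ a, h {i} = {a}ᶜ := by
    intro i
    rcases hh.card_eq_or {i} with h1 | h1
    · exact Or.inl (Finset.card_eq_one.1 (by simpa using h1))
    · right
      obtain ⟨a, ha⟩ := Finset.card_eq_one.1
        (show (h {i})ᶜ.card = 1 by rw [Finset.card_compl]; simp at h1; omega)
      exact ⟨a, by rw [← ha, compl_compl]⟩
  have hincomp : ∀ {i j}, i ≠ j → ¬ (h {i} ⊆ h {j} ∨ h {j} ⊆ h {i}) := by
    intro i j hij
    rw [hh.comparable_iff]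
    simp [hij, Ne.symm hij]
  have hmix : ∀ {i j a b}, i ≠ j → h {i} = {a} → h {j} = {b}ᶜ → a = b := by
    intro i j a b hij hi hj
    by_contra hab
    refine hincomp hij (Or.inl ?_)
    rw [hi, hj]
    simpa using Ne.symm hab
  -- If `i ↦ {a}` and `j ↦ {a}ᶜ`, a third element would have to share its image with `i` or `j`,
  -- against injectivity. This is where three elements are needed.
  have hall : (∀ i, ∃ a, h {i} = {a}) ∨ ∀ i, ∃ a, h {i} = {a}ᶜ := by
    by_contra! hc
    obtain ⟨⟨j, hj⟩, ⟨i, hi⟩⟩ := hc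
    obtain ⟨a, ha⟩ := (hS i).resolve_right (by simpa using hi)
    obtain ⟨b, hb⟩ := (hS j).resolve_left (by simpa using hj)
    have hij : i ≠ j := by rintro rfl; exact hj a ha
    have hab := hmix hij ha hb
    obtain ⟨l, -, hl⟩ : ∃ l ∈ (Finset.univ : Finset α), l ∉ ({i, j} : Finset α) :=
      Finset.exists_mem_notMem_of_card_lt_card
        (lt_of_le_of_lt Finset.card_le_two (by rw [Finset.card_univ]; omega))
    simp only [Finset.mem_insert, Finset.mem_singleton, not_or] at hl
    rcases hS l with ⟨c, hc⟩ | ⟨c, hc⟩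
    · have := hmix hl.2 hc hb
      exact hl.1 (Finset.singleton_injective (hh.injective (by rw [hc, ha, this, hab])))
    · have := hmix (Ne.symm hl.1) ha hc
      exact hl.2 (Finset.singleton_injective (hh.injective (by rw [hc, hb, ← this, hab])))
  rcases hall with hall | hall
  · obtain ⟨p, hp⟩ := exists_perm_of_map_singleton hh.injective (fun A hA _ => hh.nonempty hA)
      (fun A B _ _ _ _ => hh.comparable_iff A B) (by omega) hall
    refine ⟨p, Or.inl fun A => ?_⟩
    rcases A.eq_empty_or_nonempty with rfl | hA
    · simp [hh.map_empty]
    by_cases hA' : A = Finset.univ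
    · subst hA'
      rw [hh.map_univ, Finset.map_univ_equiv]
    · exact hp A hA hA'
  -- The complemented map still respects comparability but swaps `∅` and `univ`; hence the lemma
  -- only speaks of proper nonempty sets.
  · obtain ⟨p, hp⟩ := exists_perm_of_map_singleton (h := fun A => (h A)ᶜ)
      (fun A B hAB => hh.injective (compl_injective hAB))
      (fun A _ hA => by
        rw [Finset.nonempty_iff_ne_empty, Ne, Finset.compl_eq_empty_iff]
        exact hh.ne_univ hA)
      (fun A B _ _ _ _ => by rw [compl_comparable_iff, hh.comparable_iff]) (by omega)
      (fun i => (hall i).imp fun a ha => by simp [ha])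
    exact ⟨p, Or.inr fun A hA hA' => by rw [← hp A hA hA', compl_compl]⟩

/-- A comparability map is determined by its values on the sets avoiding one element. -/
theorem IsComparabilityMap.eq_map {h : Finset α → Finset α} (hh : IsComparabilityMap h)
    (p : Equiv.Perm α) (i : α) (hi : ∀ A : Finset α, i ∉ A → h A = A.map p.toEmbedding)
    (A : Finset α) : h A = A.map p.toEmbedding := by
  by_cases hiA : i ∈ A
  swap
  · exact hi A hiA
  have hA : A.Nonempty := ⟨i, hiA⟩
  have hmem : ∀ j, j ≠ i → (p j ∈ h A ↔ j ∈ A) := by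
    intro j hj
    have := hh.comparable_iff {j} A
    rwa [hi {j} (by simpa using hj.symm), Finset.map_singleton,
      singleton_comparable_iff (hh.nonempty hA), singleton_comparable_iff hA] at this
  -- Otherwise `A` and `A.erase i` would have the same image.
  have hpi : p i ∈ h A := by
    by_contra hc
    have h1 : h A = h (A.erase i) := by
      rw [hi (A.erase i) (Finset.notMem_erase i A)]
      ext l
      obtain ⟨j, rfl⟩ := p.surjective l
      by_cases hj : j = i
      · subst hj; simpa using hc
      · simp [hmem j hj, hj]
    exact Finset.notMem_erase i A (hh.injective h1 ▸ hiA)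
  ext l
  obtain ⟨j, rfl⟩ := p.surjective l
  by_cases hj : j = i
  · subst hj; simpa [hiA] using hpi
  · simp [hmem j hj]

end Boolean

noncomputable section

/-! ### Lattice points and faces in integer coordinates -/

/-- The lattice point `∑ a_i w_i`. -/
def latticePoint {d : ℕ} (a : Fin (d + 1) → ℤ) : Ambient d := ∑ i, a i • w i

theorem latticePoint_apply {d : ℕ} (a : Fin (d + 1) → ℤ) (j : Fin (d + 1)) :
    latticePoint a j = a j - (∑ i, (a i : ℝ)) / (d + 1) := by
  simp [latticePoint, w, mul_sub, Finset.sum_sub_distrib, div_eq_mul_inv,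
    Finset.sum_mul]

theorem latticePoint_sub {d : ℕ} (a : Fin (d + 1) → ℤ) (i j : Fin (d + 1)) :
    latticePoint a j - latticePoint a i = ((a j - a i : ℤ) : ℝ) := by
  rw [latticePoint_apply, latticePoint_apply]
  push_cast
  ring

theorem latticePoint_add {d : ℕ} (a b : Fin (d + 1) → ℤ) :
    latticePoint (a + b) = latticePoint a + latticePoint b := by
  simp [latticePoint, add_smul, Finset.sum_add_distrib]

theorem latticePoint_neg {d : ℕ} (a : Fin (d + 1) → ℤ) :
    latticePoint (-a) = -latticePoint a := by
  simp [latticePoint]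

theorem latticePoint_mem_hyperplaneV {d : ℕ} (a : Fin (d + 1) → ℤ) :
    latticePoint a ∈ hyperplaneV d := by
  change ∑ j, latticePoint a j = 0
  simp only [latticePoint_apply, Finset.sum_sub_distrib, Finset.sum_const, Finset.card_univ,
    Fintype.card_fin, nsmul_eq_mul]
  push_cast
  field_simp
  ring

theorem latticePoint_mem {d : ℕ} (a : Fin (d + 1) → ℤ) : latticePoint a ∈ weightLattice d :=
  ⟨latticePoint_mem_hyperplaneV a, fun i j => ⟨a j - a i, latticePoint_sub a i j⟩⟩

/-- Points of `V` are determined by their coordinate differences. -/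
theorem eq_of_sub_eq {d : ℕ} {x y : Ambient d} (hx : x ∈ hyperplaneV d) (hy : y ∈ hyperplaneV d)
    (h : ∀ j, x j - x 0 = y j - y 0) : x = y := by
  have hx' : ∑ j, x j = 0 := hx
  have hy' : ∑ j, y j = 0 := hy
  have h1 : ∀ j, x j - y j = x 0 - y 0 := fun j => by linarith [h j]
  have h2 : ∑ j, (x j - y j) = 0 := by rw [Finset.sum_sub_distrib, hx', hy', sub_zero]
  simp only [h1, Finset.sum_const, Finset.card_univ, Fintype.card_fin, nsmul_eq_mul] at h2
  have h3 : x 0 - y 0 = 0 := by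
    rcases mul_eq_zero.1 h2 with h | h
    · exact absurd h (by positivity)
    · exact h
  ext j
  linarith [h1 j]

theorem exists_latticePoint_eq {d : ℕ} {x : Ambient d} (hx : x ∈ weightLattice d) :
    ∃ a, x = latticePoint a := by
  choose m hm using hx.2 0
  refine ⟨m, eq_of_sub_eq hx.1 (latticePoint_mem_hyperplaneV m) fun j => ?_⟩
  have h0 := hm 0
  rw [sub_self] at h0
  rw [latticePoint_sub, hm j]
  push_cast
  rw [← h0, sub_zero]

theorem latticePoint_eq_latticePoint {d : ℕ} {a b : Fin (d + 1) → ℤ} :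
    latticePoint a = latticePoint b ↔ ∃ c, a - b = fun _ => c := by
  constructor
  · intro h
    refine ⟨a 0 - b 0, ?_⟩
    ext j
    have h1 := latticePoint_sub a 0 j
    rw [h, latticePoint_sub b 0 j, Int.cast_inj] at h1
    simp only [Pi.sub_apply]
    omega
  · rintro ⟨c, hc⟩
    have hc' : ∀ j, a j - b j = c := fun j => congrFun hc j
    refine eq_of_sub_eq (latticePoint_mem_hyperplaneV a) (latticePoint_mem_hyperplaneV b)
      fun j => ?_
    rw [latticePoint_sub, latticePoint_sub, Int.cast_inj]
    linarith [hc' j, hc' 0]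

theorem latticePoint_mem_sublattice {d k : ℕ} {a : Fin (d + 1) → ℤ} :
    latticePoint a ∈ sublattice (fun _ : Fin (d + 1) => k) ↔ a ∈ periods d k := by
  constructor
  · rintro ⟨b, hb⟩
    obtain ⟨c, hc⟩ := latticePoint_eq_latticePoint.1 hb
    rw [sub_eq_iff_eq_add] at hc
    rw [hc]
    exact add_mem (const_mem_periods c) ⟨b, rfl⟩
  · rintro ⟨b, rfl⟩
    exact ⟨b, rfl⟩

theorem exists_latticePoint_of_mem_sublattice {d k : ℕ} {v : Ambient d}
    (hv : v ∈ sublattice (fun _ : Fin (d + 1) => k)) :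
    ∃ s ∈ periods d k, v = latticePoint s := by
  obtain ⟨b, hb⟩ := id hv
  exact ⟨_, ⟨b, rfl⟩, hb⟩

theorem latticePoint_mem_closedCell {d : ℕ} {x : Ambient d} {a : Fin (d + 1) → ℤ} :
    latticePoint a ∈ closedCell x ↔ ∀ (i j : Fin (d + 1)) (m : ℤ),
      (x j - x i ≤ m → a j - a i ≤ m) ∧ (m ≤ x j - x i → m ≤ a j - a i) := by
  simp only [closedCell, Set.mem_ofPred_eq, latticePoint_mem_hyperplaneV, true_and,
    latticePoint_sub, Int.cast_le]

/-- Two lattice points whose difference oscillates by at most one. -/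
def Near {d : ℕ} (a b : Fin (d + 1) → ℤ) : Prop := ∀ i j, (a j - b j) - (a i - b i) ≤ 1

theorem IsFace.exists_mem {d : ℕ} {F : Set (Ambient d)} (hF : IsFace F) :
    ∃ a, latticePoint a ∈ F := by
  obtain ⟨x, -, rfl⟩ := hF
  -- Rounding down is monotone and commutes with integer shifts, so it respects every inequality
  -- defining the cell.
  refine ⟨fun i => ⌊x i⌋, latticePoint_mem_closedCell.2 fun i j m => ⟨fun h => ?_, fun h => ?_⟩,
    latticePoint_mem _⟩
  · have : ⌊x j⌋ ≤ ⌊x i + m⌋ := Int.floor_le_floor (by linarith)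
    rw [Int.floor_add_intCast] at this
    omega
  · have : ⌊x i + m⌋ ≤ ⌊x j⌋ := Int.floor_le_floor (by linarith)
    rw [Int.floor_add_intCast] at this
    omega

theorem IsFace.exists_eq {d : ℕ} {F : Set (Ambient d)} (hF : IsFace F) {x : Ambient d}
    (hx : x ∈ F) : ∃ a, x = latticePoint a := by
  obtain ⟨y, -, rfl⟩ := hF
  exact exists_latticePoint_eq hx.2

theorem IsFace.near {d : ℕ} {F : Set (Ambient d)} (hF : IsFace F) {a b : Fin (d + 1) → ℤ}
    (ha : latticePoint a ∈ F) (hb : latticePoint b ∈ F) : Near a b := by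
  obtain ⟨x, -, rfl⟩ := hF
  intro i j
  have h1 := (latticePoint_mem_closedCell.1 ha.1 i j ⌈x j - x i⌉).1 (Int.le_ceil _)
  have h2 := (latticePoint_mem_closedCell.1 hb.1 i j ⌊x j - x i⌋).2 (Int.floor_le _)
  have h3 := Int.ceil_le_floor_add_one (x j - x i)
  omega

/-- The cell of the barycentre works: for each `i`, `j` the three integer differences lie in some
`{n, n + 1}`, so an integer bound on their average holds for each of them. -/
theorem exists_isFace_of_near {d : ℕ} {a b c : Fin (d + 1) → ℤ} (hab : Near a b)
    (hac : Near a c) (hbc : Near b c) :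
    ∃ F, IsFace F ∧ latticePoint a ∈ F ∧ latticePoint b ∈ F ∧ latticePoint c ∈ F := by
  let x : Ambient d := fun j => (latticePoint a j + latticePoint b j + latticePoint c j) / 3
  have hx : ∀ i j, 3 * (x j - x i) =
      (((a j - a i) + (b j - b i) + (c j - c i) : ℤ) : ℝ) := by
    intro i j
    push_cast
    have h1 := latticePoint_sub a i j
    have h2 := latticePoint_sub b i j
    have h3 := latticePoint_sub c i j
    push_cast at h1 h2 h3
    simp only [x]
    linarith
  have hle : ∀ i j (m : ℤ), x j - x i ≤ m →
      (a j - a i) + (b j - b i) + (c j - c i) ≤ 3 * m := by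
    intro i j m h
    have := hx i j
    exact_mod_cast (by push_cast at *; linarith :
      (((a j - a i) + (b j - b i) + (c j - c i) : ℤ) : ℝ) ≤ ((3 * m : ℤ) : ℝ))
  have hge : ∀ i j (m : ℤ), m ≤ x j - x i →
      3 * m ≤ (a j - a i) + (b j - b i) + (c j - c i) := by
    intro i j m h
    have := hx i j
    exact_mod_cast (by push_cast at *; linarith :
      ((3 * m : ℤ) : ℝ) ≤ (((a j - a i) + (b j - b i) + (c j - c i) : ℤ) : ℝ))
  have hV : x ∈ hyperplaneV d := by
    have ha : ∑ j, latticePoint a j = 0 := latticePoint_mem_hyperplaneV a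
    have hb : ∑ j, latticePoint b j = 0 := latticePoint_mem_hyperplaneV b
    have hc : ∑ j, latticePoint c j = 0 := latticePoint_mem_hyperplaneV c
    change ∑ j, (latticePoint a j + latticePoint b j + latticePoint c j) / 3 = 0
    rw [← Finset.sum_div, Finset.sum_add_distrib, Finset.sum_add_distrib, ha, hb, hc]
    simp
  refine ⟨_, ⟨x, hV, rfl⟩, ⟨latticePoint_mem_closedCell.2 fun i j m => ?_, latticePoint_mem _⟩,
    ⟨latticePoint_mem_closedCell.2 fun i j m => ?_, latticePoint_mem _⟩,
    ⟨latticePoint_mem_closedCell.2 fun i j m => ?_, latticePoint_mem _⟩⟩ <;>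
  · have h1 := hle i j m
    have h2 := hge i j m
    have h3 := hab i j
    have h4 := hab j i
    have h5 := hac i j
    have h6 := hac j i
    have h7 := hbc i j
    have h8 := hbc j i
    exact ⟨fun h => by have := h1 h; omega, fun h => by have := h2 h; omega⟩

theorem isFace_singleton {d : ℕ} (a : Fin (d + 1) → ℤ) : IsFace {latticePoint a} := by
  refine ⟨latticePoint a, latticePoint_mem_hyperplaneV a, ?_⟩
  ext x
  simp only [Set.mem_singleton_iff]
  constructor
  · rintro rfl
    exact ⟨⟨latticePoint_mem_hyperplaneV a, fun i j m => ⟨id, id⟩⟩, latticePoint_mem a⟩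
  · rintro ⟨⟨hx, h⟩, -⟩
    refine eq_of_sub_eq hx (latticePoint_mem_hyperplaneV a) fun j => ?_
    have hj := latticePoint_sub a 0 j
    rw [hj]
    exact le_antisymm ((h 0 j _).1 hj.le) ((h 0 j _).2 hj.ge)

/-! ### Vertices of the quotient complex -/

variable {d k : ℕ}

/-- The class of the vertex `∑ a_i w_i` in `T_{(k,…,k)}`. -/
def vert (k : ℕ) (a : Fin (d + 1) → ℤ) : Torus (fun _ : Fin (d + 1) => k) :=
  Torus.mk _ ⟨{latticePoint a}, isFace_singleton a⟩

theorem mk_eq_mk {F F' : Face d} :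
    Torus.mk (fun _ : Fin (d + 1) => k) F = Torus.mk _ F' ↔
      ∃ s ∈ periods d k, F'.1 = (fun x => x + latticePoint s) '' F.1 := by
  refine Quotient.eq.trans ⟨?_, ?_⟩
  · rintro ⟨v, hv, h⟩
    obtain ⟨s, hs, rfl⟩ := exists_latticePoint_of_mem_sublattice hv
    exact ⟨s, hs, h⟩
  · rintro ⟨s, hs, h⟩
    exact ⟨_, latticePoint_mem_sublattice.2 hs, h⟩

theorem vert_eq_vert {a b : Fin (d + 1) → ℤ} : vert k a = vert k b ↔ b - a ∈ periods d k := by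
  refine mk_eq_mk.trans ⟨?_, fun h => ⟨b - a, h, ?_⟩⟩
  · rintro ⟨s, hs, h⟩
    rw [Set.image_singleton, Set.singleton_eq_singleton_iff, ← latticePoint_add] at h
    obtain ⟨c, hc⟩ := latticePoint_eq_latticePoint.1 h
    rw [show b - a = (b - (a + s)) + s by abel, hc]
    exact add_mem (const_mem_periods c) hs
  · rw [Set.image_singleton, ← latticePoint_add, add_sub_cancel]

theorem vert_add_period (a : Fin (d + 1) → ℤ) {s : Fin (d + 1) → ℤ} (hs : s ∈ periods d k) :
    vert k (a + s) = vert k a :=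
  (vert_eq_vert.2 (by simpa using hs)).symm

theorem mem_translate {F : Set (Ambient d)} {a s : Fin (d + 1) → ℤ} :
    latticePoint a ∈ (fun x => x + latticePoint s) '' F ↔ latticePoint (a - s) ∈ F := by
  rw [sub_eq_add_neg, latticePoint_add, latticePoint_neg, ← sub_eq_add_neg]
  constructor
  · rintro ⟨y, hy, h⟩
    rwa [← h, add_sub_cancel_right]
  · exact fun h => ⟨_, h, sub_add_cancel _ _⟩

theorem vert_le_mk {a : Fin (d + 1) → ℤ} {F : Face d} :
    vert k a ≤ Torus.mk _ F ↔ ∃ s ∈ periods d k, latticePoint (a + s) ∈ F.1 := by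
  constructor
  · rintro ⟨A, B, hA, hB, h⟩
    obtain ⟨s, hs, h1⟩ := mk_eq_mk.1 hA.symm
    obtain ⟨t, ht, h2⟩ := mk_eq_mk.1 hB
    refine ⟨s + t, add_mem hs ht, ?_⟩
    rw [h2, mem_translate, ← add_assoc, add_sub_cancel_right, latticePoint_add]
    apply h
    rw [h1]
    simp
  · rintro ⟨s, hs, h⟩
    refine ⟨⟨{latticePoint (a + s)}, isFace_singleton _⟩, F, vert_add_period a hs, rfl, ?_⟩
    simpa using h

theorem exists_vert_le (t : Torus (fun _ : Fin (d + 1) => k)) : ∃ a, vert k a ≤ t := by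
  obtain ⟨F, rfl⟩ := Quotient.exists_rep t
  obtain ⟨a, ha⟩ := F.2.exists_mem
  exact ⟨a, vert_le_mk.2 ⟨0, zero_mem _, by simpa using ha⟩⟩

theorem eq_vert_of_le {t : Torus (fun _ : Fin (d + 1) => k)} {a : Fin (d + 1) → ℤ}
    (h : t ≤ vert k a) : t = vert k a := by
  obtain ⟨A, B, rfl, hB, hAB⟩ := h
  obtain ⟨s, hs, h1⟩ := mk_eq_mk.1 hB.symm
  obtain ⟨b, hb⟩ := A.2.exists_mem
  rw [Set.image_singleton] at h1
  rw [h1, Set.subset_singleton_iff_eq] at hAB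
  refine mk_eq_mk.2 ⟨-s, neg_mem hs, ?_⟩
  rcases hAB with h2 | h2
  · rw [h2] at hb
    exact absurd hb (Set.notMem_empty _)
  · rw [h2, Set.image_singleton, ← latticePoint_add, ← latticePoint_add, add_neg_cancel_right]

/-- Automorphisms map vertices to vertices. -/
theorem exists_map_vert (f : TorusAut (fun _ : Fin (d + 1) => k)) (a : Fin (d + 1) → ℤ) :
    ∃ b, f (vert k a) = vert k b := by
  obtain ⟨b, hb⟩ := exists_vert_le (f (vert k a))
  refine ⟨b, ?_⟩
  have h := eq_vert_of_le ((OrderIso.symm_apply_le f).2 hb)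
  rw [← h, OrderIso.apply_symm_apply]

/-- Faces of the quotient complex are determined by their vertices. -/
theorem mk_eq_mk_of_vert (hk : 1 ≤ k) {t t' : Torus (fun _ : Fin (d + 1) => k)}
    (h : ∀ a, vert k a ≤ t ↔ vert k a ≤ t') : t = t' := by
  obtain ⟨F, rfl⟩ := Quotient.exists_rep t
  obtain ⟨F', rfl⟩ := Quotient.exists_rep t'
  change ∀ a, vert k a ≤ Torus.mk _ F ↔ vert k a ≤ Torus.mk _ F' at h
  simp only [vert_le_mk] at h
  obtain ⟨a, ha⟩ := F.2.exists_mem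
  obtain ⟨s, hs, hs'⟩ := (h a).1 ⟨0, zero_mem _, by simpa using ha⟩
  -- Faces with the same vertex classes must match under one common translation: any period `t`
  -- carrying a vertex of `F` into `F'` differs from `s` by oscillation at most 2, hence by a
  -- constant.
  have key : ∀ b t : Fin (d + 1) → ℤ, t ∈ periods d k → Near a b → Near (a + s) (b + t) →
      latticePoint t = latticePoint s := by
    intro b t ht h1 h2
    obtain ⟨c, hc⟩ := eq_const_of_mem_periods hk (sub_mem ht hs) fun i j => by
      have h3 := h1 j i
      have h4 := h2 i j
      simp only [Pi.sub_apply, Pi.add_apply] at *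
      omega
    exact latticePoint_eq_latticePoint.2 ⟨c, hc⟩
  refine mk_eq_mk.2 ⟨s, hs, ?_⟩
  ext x
  constructor
  · intro hx
    obtain ⟨b, rfl⟩ := F'.2.exists_eq hx
    rw [mem_translate]
    obtain ⟨t, ht, ht'⟩ := (h b).2 ⟨0, zero_mem _, by simpa using hx⟩
    have := key (b + t) (-t) (neg_mem ht) (F.2.near ha ht')
      (by simpa using F'.2.near hs' hx)
    rw [latticePoint_neg, neg_eq_iff_eq_neg, ← latticePoint_neg] at this
    rwa [sub_eq_add_neg, latticePoint_add, ← this, ← latticePoint_add]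
  · intro hx
    obtain ⟨y, hy, rfl⟩ := hx
    obtain ⟨b, rfl⟩ := F.2.exists_eq hy
    obtain ⟨t, ht, ht'⟩ := (h b).1 ⟨0, zero_mem _, by simpa using hy⟩
    have := key b t ht (F.2.near ha hy) (F'.2.near hs' ht')
    simpa [← this, ← latticePoint_add] using ht'

/-- Automorphisms are determined by their action on vertices. -/
theorem aut_ext (hk : 1 ≤ k) {f g : TorusAut (fun _ : Fin (d + 1) => k)}
    (h : ∀ a, f (vert k a) = g (vert k a)) : f = g := by
  refine RelIso.ext fun t => mk_eq_mk_of_vert hk fun a => ?_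
  obtain ⟨b, hb⟩ := exists_map_vert f.symm a
  have h1 : f (vert k b) = vert k a := by rw [← hb, OrderIso.apply_symm_apply]
  rw [← h1, OrderIso.le_iff_le, h, OrderIso.le_iff_le]

/-- A common period can be subtracted from all three vertices, so the first one may be kept fixed.
-/
theorem exists_le_iff_near {a b c : Fin (d + 1) → ℤ} :
    (∃ t, vert k a ≤ t ∧ vert k b ≤ t ∧ vert k c ≤ t) ↔
      ∃ s ∈ periods d k, ∃ t ∈ periods d k,
        Near a (b + s) ∧ Near a (c + t) ∧ Near (b + s) (c + t) := by
  constructor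
  · rintro ⟨F, ha, hb, hc⟩
    obtain ⟨F, rfl⟩ := Quotient.exists_rep F
    obtain ⟨r, hr, ha⟩ := vert_le_mk.1 ha
    obtain ⟨s, hs, hb⟩ := vert_le_mk.1 hb
    obtain ⟨t, ht, hc⟩ := vert_le_mk.1 hc
    have h1 := F.2.near ha hb
    have h2 := F.2.near ha hc
    have h3 := F.2.near hb hc
    refine ⟨s - r, sub_mem hs hr, t - r, sub_mem ht hr, fun i j => ?_, fun i j => ?_,
      fun i j => ?_⟩
    · have := h1 i j
      simp only [Pi.add_apply, Pi.sub_apply] at *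
      omega
    · have := h2 i j
      simp only [Pi.add_apply, Pi.sub_apply] at *
      omega
    · have := h3 i j
      simp only [Pi.add_apply, Pi.sub_apply] at *
      omega
  · rintro ⟨s, hs, t, ht, h1, h2, h3⟩
    obtain ⟨F, hF, ha, hb, hc⟩ := exists_isFace_of_near h1 h2 h3
    exact ⟨Torus.mk _ ⟨F, hF⟩, vert_le_mk.2 ⟨0, zero_mem _, by simpa using ha⟩,
      vert_le_mk.2 ⟨s, hs, hb⟩, vert_le_mk.2 ⟨t, ht, hc⟩⟩

theorem exists_le_map_iff (f : TorusAut (fun _ : Fin (d + 1) => k))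
    (x y z : Torus (fun _ : Fin (d + 1) => k)) :
    (∃ t, f x ≤ t ∧ f y ≤ t ∧ f z ≤ t) ↔ ∃ t, x ≤ t ∧ y ≤ t ∧ z ≤ t := by
  constructor
  · rintro ⟨t, h1, h2, h3⟩
    exact ⟨f.symm t, (OrderIso.le_symm_apply f).2 h1, (OrderIso.le_symm_apply f).2 h2,
      (OrderIso.le_symm_apply f).2 h3⟩
  · rintro ⟨t, h1, h2, h3⟩
    exact ⟨f t, (OrderIso.le_iff_le f).2 h1, (OrderIso.le_iff_le f).2 h2,
      (OrderIso.le_iff_le f).2 h3⟩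

end

/-! ### Automorphisms near a vertex -/

variable {d k : ℕ}

/-- The indicator vector of a set of indices. -/
def ind (A : Finset (Fin (d + 1))) : Fin (d + 1) → ℤ := fun i => if i ∈ A then 1 else 0

theorem ind_empty : ind (∅ : Finset (Fin (d + 1))) = 0 := by
  ext i; simp [ind]

theorem ind_univ : ind (Finset.univ : Finset (Fin (d + 1))) = fun _ => 1 := by
  ext i; simp [ind]

theorem ind_compl (A : Finset (Fin (d + 1))) : ind Aᶜ = (fun _ => 1) - ind A := by
  ext i
  by_cases h : i ∈ A <;> simp [ind, h]

theorem ind_map (p : Equiv.Perm (Fin (d + 1))) (A : Finset (Fin (d + 1))) :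
    ind (A.map p.toEmbedding) = ind A ∘ p.symm := by
  ext i
  simp [ind, Finset.mem_map_equiv]

theorem ind_insert {A : Finset (Fin (d + 1))} {i : Fin (d + 1)} (h : i ∉ A) :
    ind (insert i A) = ind {i} + ind A := by
  ext j
  by_cases hj : j = i
  · subst hj; simp [ind, h]
  · simp [ind, hj]

theorem vert_add_ind_univ (a : Fin (d + 1) → ℤ) : vert k (a + ind Finset.univ) = vert k a :=
  vert_add_period a (by rw [ind_univ]; exact const_mem_periods 1)

theorem near_ind_iff (a : Fin (d + 1) → ℤ) (A B : Finset (Fin (d + 1))) (c e : ℤ) :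
    Near (a + ind A + fun _ => c) (a + ind B + fun _ => e) ↔ A ⊆ B ∨ B ⊆ A := by
  constructor
  · intro h
    by_contra! hc
    obtain ⟨⟨i, hi, hi'⟩, ⟨j, hj, hj'⟩⟩ := hc.imp Finset.not_subset.1 Finset.not_subset.1
    have := h j i
    simp only [Pi.add_apply, ind, hi, hi', hj, hj', if_true, if_false] at this
    omega
  · intro h i j
    have h1 : (i ∈ A → i ∈ B) ∧ (j ∈ A → j ∈ B) ∨ (i ∈ B → i ∈ A) ∧ (j ∈ B → j ∈ A) :=
      h.imp (fun h => ⟨fun x => h x, fun x => h x⟩) (fun h => ⟨fun x => h x, fun x => h x⟩)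
    simp only [Pi.add_apply, ind]
    split_ifs <;> first | omega | tauto

theorem exists_eq_add_ind_of_near {a b : Fin (d + 1) → ℤ} (h : Near a b) :
    ∃ A c, b = a + ind A + fun _ => c := by
  obtain ⟨q, hq⟩ := Finite.exists_min fun j => b j - a j
  -- The difference `b - a` takes at most two consecutive values; `A` is where it is not minimal.
  refine ⟨Finset.univ.filter fun j => b j - a j ≠ b q - a q, b q - a q, ?_⟩
  ext j
  have h1 := hq j
  have h2 := h j q
  simp only [Pi.add_apply, ind, Finset.mem_filter, Finset.mem_univ, true_and]
  split_ifs with hj <;> omega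

theorem exists_const_of_near (hk : 1 ≤ k) {a s : Fin (d + 1) → ℤ} {A : Finset (Fin (d + 1))}
    (hs : s ∈ periods d k) (h : Near a (a + ind A + s)) : ∃ c, s = fun _ => c := by
  refine eq_const_of_mem_periods hk hs fun i j => ?_
  have h1 := h i j
  simp only [Pi.add_apply, ind] at h1
  split_ifs at h1 <;> omega

/-- The stars of vertices embed into the quotient complex. -/
theorem exists_le_add_ind_iff (hk : 1 ≤ k) {a : Fin (d + 1) → ℤ} {A B : Finset (Fin (d + 1))} :
    (∃ t, vert k a ≤ t ∧ vert k (a + ind A) ≤ t ∧ vert k (a + ind B) ≤ t) ↔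
      A ⊆ B ∨ B ⊆ A := by
  rw [exists_le_iff_near]
  constructor
  · rintro ⟨s, hs, t, ht, h1, h2, h3⟩
    obtain ⟨c, rfl⟩ := exists_const_of_near hk hs h1
    obtain ⟨e, rfl⟩ := exists_const_of_near hk ht h2
    exact (near_ind_iff a A B c e).1 h3
  · intro h
    have h0 : ∀ C, Near a (a + ind C + fun _ => (0 : ℤ)) := fun C => by
      have := (near_ind_iff a ∅ C 0 0).2 (Or.inl (Finset.empty_subset C))
      rw [ind_empty] at this
      convert this using 1
      ext j; simp
    exact ⟨fun _ => 0, const_mem_periods 0, fun _ => 0, const_mem_periods 0, h0 A, h0 B,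
      (near_ind_iff a A B 0 0).2 h⟩

theorem eq_of_vert_add_ind_eq (hk : 1 ≤ k) {a : Fin (d + 1) → ℤ} {A B : Finset (Fin (d + 1))}
    (h : vert k (a + ind A) = vert k (a + ind B)) :
    A = B ∨ A = ∅ ∧ B = Finset.univ ∨ A = Finset.univ ∧ B = ∅ := by
  rw [vert_eq_vert] at h
  obtain ⟨c, hc⟩ := eq_const_of_mem_periods hk h fun i j => by
    simp only [Pi.add_apply, Pi.sub_apply, ind]
    split_ifs <;> omega
  have hc' : ∀ i, ind B i - ind A i = c := fun i => by
    have := congrFun hc i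
    simp only [Pi.add_apply, Pi.sub_apply] at this
    omega
  simp only [ind] at hc'
  have h0 := hc' 0
  have : c = 0 ∨ c = 1 ∨ c = -1 := by split_ifs at h0 <;> omega
  rcases this with rfl | rfl | rfl
  · left
    ext i
    have := hc' i
    split_ifs at this <;> simp_all
  · right; left
    constructor <;> ext i <;> have := hc' i <;> split_ifs at this <;> simp_all
  · right; right
    constructor <;> ext i <;> have := hc' i <;> split_ifs at this <;> simp_all

/-- An automorphism acts on the star of a vertex as a comparability map of index sets. -/
theorem exists_isComparabilityMap (hk : 1 ≤ k) (f : TorusAut (fun _ : Fin (d + 1) => k))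
    {a b : Fin (d + 1) → ℤ} (hab : f (vert k a) = vert k b) :
    ∃ h : Finset (Fin (d + 1)) → Finset (Fin (d + 1)), IsComparabilityMap h ∧
      ∀ A, f (vert k (a + ind A)) = vert k (b + ind (h A)) := by
  have hne : (∅ : Finset (Fin (d + 1))) ≠ Finset.univ := Finset.univ_nonempty.ne_empty.symm
  have hex : ∀ A : Finset (Fin (d + 1)), ∃ B, f (vert k (a + ind A)) = vert k (b + ind B) := by
    intro A
    obtain ⟨c, hc⟩ := exists_map_vert f (a + ind A)
    have h1 := (exists_le_map_iff f (vert k a) (vert k (a + ind A)) (vert k (a + ind A))).2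
      ((exists_le_add_ind_iff hk).2 (Or.inl subset_rfl))
    rw [hab, hc, exists_le_iff_near] at h1
    obtain ⟨s, hs, -, -, h2, -⟩ := h1
    obtain ⟨B, e, he⟩ := exists_eq_add_ind_of_near h2
    exact ⟨B, by rw [hc, ← vert_add_period c hs, he, vert_add_period _ (const_mem_periods e)]⟩
  -- `∅` and `univ` both label the centre of the star, so their images must be chosen by hand to
  -- make the set map injective.
  have hex' : ∀ A : Finset (Fin (d + 1)), ∃ B, f (vert k (a + ind A)) = vert k (b + ind B) ∧
      (A = ∅ → B = ∅) ∧ (A = Finset.univ → B = Finset.univ) := by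
    intro A
    by_cases h1 : A = ∅
    · subst h1
      exact ⟨∅, by simpa [ind_empty] using hab, fun _ => rfl, fun h => absurd h hne⟩
    by_cases h2 : A = Finset.univ
    · subst h2
      exact ⟨Finset.univ, by rw [vert_add_ind_univ, vert_add_ind_univ, hab],
        fun h => absurd h h1, fun _ => rfl⟩
    obtain ⟨B, hB⟩ := hex A
    exact ⟨B, hB, fun h => absurd h h1, fun h => absurd h h2⟩
  choose h hf h0 h1 using hex'
  refine ⟨h, ⟨fun A B hAB => ?_, h0 ∅ rfl, h1 _ rfl, fun A B => ?_⟩, hf⟩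
  · have h2 : vert k (a + ind A) = vert k (a + ind B) := f.injective (by rw [hf, hf, hAB])
    rcases eq_of_vert_add_ind_eq hk h2 with h3 | ⟨rfl, rfl⟩ | ⟨rfl, rfl⟩
    · exact h3
    · rw [h0 _ rfl, h1 _ rfl] at hAB
      exact absurd hAB hne
    · rw [h0 _ rfl, h1 _ rfl] at hAB
      exact absurd hAB.symm hne
  · rw [← exists_le_add_ind_iff hk (a := b), ← exists_le_add_ind_iff hk (a := a), ← hab, ← hf,
      ← hf, exists_le_map_iff]

/-! ### Rigidity -/

theorem add_comp (a b : Fin (d + 1) → ℤ) (p : Equiv.Perm (Fin (d + 1))) :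
    (a + b) ∘ p = a ∘ p + b ∘ p := rfl

/-- An automorphism that acts by a permutation of coordinates on one star acts in the same way on
the adjacent stars. -/
theorem map_star_add_ind_singleton (hk : 1 ≤ k) {f : TorusAut (fun _ : Fin (d + 1) => k)}
    {p : Equiv.Perm (Fin (d + 1))} {a : Fin (d + 1) → ℤ}
    (h : ∀ A, f (vert k (a + ind A)) = vert k ((a + ind A) ∘ p.symm)) (i : Fin (d + 1))
    (A : Finset (Fin (d + 1))) :
    f (vert k (a + ind {i} + ind A)) = vert k ((a + ind {i} + ind A) ∘ p.symm) := by
  obtain ⟨g, hg, hf⟩ := exists_isComparabilityMap hk f (h {i})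
  have hA : g A = A.map p.toEmbedding := by
    -- For `i ∉ D` the vertex `a + ind {i} + ind D` also lies in the star of `a`, where `f` is
    -- known.
    refine hg.eq_map p i (fun D hD => ?_) A
    have h1 := h (insert i D)
    rw [ind_insert hD, ← add_assoc, hf, add_comp _ (ind D), ← ind_map] at h1
    rcases eq_of_vert_add_ind_eq hk h1 with h2 | ⟨h2, h3⟩ | ⟨h2, h3⟩
    · exact h2
    · have h4 : D = ∅ := hg.injective (h2.trans hg.map_empty.symm)
      rw [h4, Finset.map_empty] at h3 ⊢
      exact hg.map_empty
    · rw [Finset.map_eq_empty] at h3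
      rw [h3, Finset.map_empty]
      exact hg.map_empty
  rw [hf, hA, ind_map, ← add_comp]

/-- An automorphism that acts by a permutation of coordinates on the star of the origin acts
by that permutation everywhere. -/
theorem map_vert_of_star_zero (hk : 1 ≤ k) {f : TorusAut (fun _ : Fin (d + 1) => k)}
    {p : Equiv.Perm (Fin (d + 1))}
    (h : ∀ A, f (vert k (ind A)) = vert k (ind A ∘ p.symm)) (a : Fin (d + 1) → ℤ) :
    f (vert k a) = vert k (a ∘ p.symm) := by
  let P : (Fin (d + 1) → ℤ) → Prop := fun a =>
    ∀ A, f (vert k (a + ind A)) = vert k ((a + ind A) ∘ p.symm)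
  -- Steps that propagate `P` form a monoid containing the unit vectors. Subtracting the minimum of
  -- `a`, a constant and so a period, makes `a` nonnegative and therefore reachable.
  let N : AddSubmonoid (Fin (d + 1) → ℤ) :=
    { carrier := {u | ∀ a, P a → P (a + u)}
      zero_mem' := fun a ha => by simpa using ha
      add_mem' := fun {u v} hu hv a ha => by
        rw [← add_assoc]
        exact hv _ (hu _ ha) }
  have hN : ∀ i, ind {i} ∈ N := fun i a ha => map_star_add_ind_singleton hk ha i
  obtain ⟨q, hq⟩ := Finite.exists_min a
  have hb : (a - fun _ => a q) = ∑ i, (a i - a q).toNat • ind {i} := by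
    ext j
    simp only [Pi.sub_apply, Finset.sum_apply, Pi.smul_apply, ind, Finset.mem_singleton,
      smul_ite, smul_zero, Finset.sum_ite_eq, Finset.mem_univ, if_true]
    rw [nsmul_eq_mul, mul_one]
    have := hq j
    omega
  have hP : P (a - fun _ => a q) := by
    have h0 : P 0 := fun A => by simpa using h A
    have := (hb ▸ sum_mem fun i _ => nsmul_mem (hN i) _ : (a - fun _ => a q) ∈ N) 0 h0
    rwa [zero_add] at this
  have := hP ∅
  rw [ind_empty, add_zero, sub_eq_add_neg] at this
  rw [vert_add_period _ (neg_mem (const_mem_periods _)), add_comp] at this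
  exact this.trans (vert_add_period _ (neg_mem (const_mem_periods (a q))))

/-- A permutation of coordinates that preserves the period lattice is cyclic. -/
theorem apply_add_one_of_map_periods (hk : 1 ≤ k) {p : Equiv.Perm (Fin (d + 1))}
    (hp : ∀ s ∈ periods d k, s ∘ p.symm ∈ periods d k) (i : Fin (d + 1)) :
    p (i + 1) = p i + 1 := by
  have row : ∀ i : Fin (d + 1), (fun j => ((k : ℤ) + 1) * ind {i} j - k * ind {i + 1} j) ∈
      periods d k := by
    intro i
    refine ⟨ind {i}, ?_⟩
    ext j
    rw [Matrix.vecMulLinear_apply, vecMul_M]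
    simp [ind, sub_eq_iff_eq_add]
  have h1 := hp _ (row i)
  -- The `k + 1` entries cancel, leaving `k` times `ind {p i + 1} - ind {p (i + 1)}`.
  have h2 := sub_mem h1 (row (p i))
  have h3 : (ind {p i + 1} - ind {p (i + 1)}) ∈ periods d k := by
    refine mem_periods_of_smul_mem hk ?_
    convert h2 using 1
    ext j
    simp only [Pi.sub_apply, Function.comp_apply, ind, Finset.mem_singleton, Equiv.symm_apply_eq]
    ring
  have h4 : vert k (0 + ind {p (i + 1)}) = vert k (0 + ind {p i + 1}) := by
    rw [vert_eq_vert]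
    simpa using h3
  rcases eq_of_vert_add_ind_eq hk h4 with h5 | ⟨h5, -⟩ | ⟨-, h5⟩
  · exact Finset.singleton_injective h5
  · simp at h5
  · simp at h5

open Fin.NatCast Fin.CommRing in
theorem apply_eq_add {p : Equiv.Perm (Fin (d + 1))} (hp : ∀ i, p (i + 1) = p i + 1)
    (i : Fin (d + 1)) : p i = i + p 0 :=
  forall_of_forall_sub_one (j₀ := 0) (P := fun i => p i = i + p 0) (by simp) (fun j hj => by
    have := hp (j - 1)
    rw [sub_add_cancel, hj] at this
    rw [sub_add_eq_add_sub, this, add_sub_cancel_right]) i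

/-! ### The automorphism group -/

variable {d k : ℕ}

theorem translation_vert (v a : Fin (d + 1) → ℤ) :
    translation (fun _ => k) ⟨latticePoint v, latticePoint_mem v⟩ (vert k a) = vert k (a + v) := by
  refine congrArg (Torus.mk _) (Subtype.ext ?_)
  change Equiv.addRight (latticePoint v) '' {latticePoint a} = {latticePoint (a + v)}
  rw [Set.image_singleton, Equiv.coe_addRight, latticePoint_add]

theorem signReversal_vert (a : Fin (d + 1) → ℤ) :
    signReversal (fun _ => k) (vert k a) = vert k (-a) := by
  refine congrArg (Torus.mk _) (Subtype.ext ?_)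
  change Equiv.neg (Ambient d) '' {latticePoint a} = {latticePoint (-a)}
  rw [Set.image_singleton, Equiv.neg_apply, latticePoint_neg]

theorem permCoords_latticePoint (p : Equiv.Perm (Fin (d + 1))) (a : Fin (d + 1) → ℤ) :
    permCoords p (latticePoint a) = latticePoint (a ∘ p.symm) := by
  ext j
  rw [permCoords_apply, latticePoint_apply, latticePoint_apply,
    ← Equiv.sum_comp p.symm fun i => (a i : ℝ)]
  rfl

theorem cyclicShift_vert (a : Fin (d + 1) → ℤ) :
    cyclicShift d k (vert k a) = vert k fun j => a (j - 1) := by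
  refine congrArg (Torus.mk _) (Subtype.ext ?_)
  change permCoords (Equiv.addRight 1) '' {latticePoint a} = _
  rw [Set.image_singleton, permCoords_latticePoint]
  simp only [sub_eq_add_neg]
  rfl

open Fin.NatCast Fin.CommRing in
theorem cyclicShift_pow_vert (m : ℕ) (a : Fin (d + 1) → ℤ) :
    (cyclicShift d k ^ m) (vert k a) = vert k fun j => a (j - (m : Fin (d + 1))) := by
  induction m generalizing a with
  | zero => simp
  | succ m ih =>
    rw [pow_succ, RelIso.mul_apply, cyclicShift_vert, ih]
    simp [sub_sub]

open Fin.NatCast Fin.CommRing in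
theorem cyclicShift_pow_val_vert (c : Fin (d + 1)) (a : Fin (d + 1) → ℤ) :
    (cyclicShift d k ^ c.val) (vert k a) = vert k fun j => a (j - c) := by
  rw [cyclicShift_pow_vert, Fin.cast_val_eq_self]

/-- The automorphism composed of an optional sign reversal, a cyclic shift and a translation. -/
noncomputable def standardAut (k : ℕ) (v : Fin (d + 1) → ℤ) (c : Fin (d + 1)) (e : Bool) :
    TorusAut (fun _ : Fin (d + 1) => k) :=
  translation (fun _ => k) ⟨latticePoint v, latticePoint_mem v⟩ *
    (cyclicShift d k ^ c.val * if e then signReversal (fun _ => k) else 1)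

theorem standardAut_vert (v : Fin (d + 1) → ℤ) (c : Fin (d + 1)) (e : Bool)
    (a : Fin (d + 1) → ℤ) :
    standardAut k v c e (vert k a) =
      vert k ((fun j => (if e then -a else a) (j - c)) + v) := by
  cases e
  · simp only [standardAut, RelIso.mul_apply, Bool.false_eq_true, if_false, RelIso.one_apply,
      cyclicShift_pow_val_vert, translation_vert]
  · simp only [standardAut, RelIso.mul_apply, if_true, signReversal_vert,
      cyclicShift_pow_val_vert, translation_vert]

theorem signReversal_mul_self :
    signReversal (fun _ : Fin (d + 1) => k) * signReversal (fun _ => k) = 1 := by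
  refine RelIso.ext fun t => ?_
  obtain ⟨F⟩ := t
  refine congrArg (Torus.mk _) (Subtype.ext ?_)
  change Equiv.neg (Ambient d) '' (Equiv.neg (Ambient d) '' F.1) = F.1
  simp [Set.image_image]

/-- Automorphisms that fix the origin and permute its neighbours `w_i` are cyclic shifts. -/
theorem exists_eq_cyclicShift_pow (hk : 1 ≤ k) {f : TorusAut (fun _ : Fin (d + 1) => k)}
    {p : Equiv.Perm (Fin (d + 1))}
    (h : ∀ A, f (vert k (ind A)) = vert k (ind A ∘ p.symm)) :
    ∃ c : Fin (d + 1), f = cyclicShift d k ^ c.val := by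
  have hf := map_vert_of_star_zero hk h
  -- A period `s` represents the same vertex as `0`, so its image `s ∘ p.symm` is again a period.
  have hp := apply_eq_add (apply_add_one_of_map_periods hk (p := p) fun s hs => by
    have h1 := hf s
    rw [(vert_eq_vert.2 (by simpa using hs) : vert k 0 = vert k s).symm, hf 0, vert_eq_vert] at h1
    simpa using h1)
  refine ⟨p 0, aut_ext hk fun a => ?_⟩
  rw [hf, cyclicShift_pow_val_vert]
  congr 1
  ext j
  rw [Function.comp_apply, (Equiv.symm_apply_eq p (y := j - p 0)).2]
  rw [hp, sub_add_cancel]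

theorem exists_eq_standardAut (hd : 2 ≤ d) (hk : 1 ≤ k)
    (f : TorusAut (fun _ : Fin (d + 1) => k)) {v : Fin (d + 1) → ℤ}
    (hv : f (vert k 0) = vert k v) : ∃ c e, f = standardAut k v c e := by
  set t := translation (fun _ : Fin (d + 1) => k) ⟨latticePoint v, latticePoint_mem v⟩
  have h0 : (t⁻¹ * f) (vert k 0) = vert k 0 := by
    rw [RelIso.mul_apply, hv]
    refine t.injective ?_
    rw [RelIso.apply_inv_self, translation_vert, zero_add]
  obtain ⟨g, hg, hfg⟩ := exists_isComparabilityMap hk _ h0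
  simp only [zero_add] at hfg
  obtain ⟨p, hp | hp⟩ := hg.exists_perm (by rw [Fintype.card_fin]; omega)
  · obtain ⟨c, hc⟩ := exists_eq_cyclicShift_pow hk (f := t⁻¹ * f) (p := p) fun A => by
      rw [hfg, hp, ind_map]
    refine ⟨c, false, ?_⟩
    rw [standardAut, if_neg Bool.false_ne_true, mul_one, ← hc, mul_inv_cancel_left]
  · obtain ⟨c, hc⟩ := exists_eq_cyclicShift_pow hk
      (f := t⁻¹ * f * signReversal (fun _ : Fin (d + 1) => k)) (p := p) fun A => by
      have hneg : vert k (-ind A) = vert k (ind Aᶜ) := by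
        rw [ind_compl, sub_eq_add_neg, add_comm _ (-ind A),
          vert_add_period _ (const_mem_periods 1)]
      rw [RelIso.mul_apply, signReversal_vert, hneg, hfg]
      -- The complement formula excludes `∅` and `univ`, but both label the origin.
      by_cases hA : A = ∅
      · subst hA
        rw [Finset.compl_empty, hg.map_univ, ind_empty, ← zero_add (ind Finset.univ),
          vert_add_ind_univ]
        rfl
      by_cases hA' : A = Finset.univ
      · subst hA'
        rw [Finset.compl_univ, hg.map_empty, ind_empty, ← ind_map, Finset.map_univ_equiv,
          ← zero_add (ind Finset.univ), vert_add_ind_univ]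
      · rw [hp _ (by rwa [Finset.nonempty_iff_ne_empty, Ne, Finset.compl_eq_empty_iff])
          (by rwa [Ne, Finset.compl_eq_univ_iff]), ← ind_map]
        congr 2
        ext i
        simp [Finset.mem_map_equiv]
    refine ⟨c, true, ?_⟩
    rw [standardAut, if_pos rfl, ← hc, mul_assoc, mul_assoc, signReversal_mul_self, mul_one,
      mul_inv_cancel_left]

theorem eq_of_standardAut_eq (hd : 2 ≤ d) (hk : 1 ≤ k) {v v' : Fin (d + 1) → ℤ}
    {c c' : Fin (d + 1)} {e e' : Bool} (h : standardAut k v c e = standardAut k v' c' e') :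
    v - v' ∈ periods d k ∧ c = c' ∧ e = e' := by
  have h0 : v' - v ∈ periods d k := by
    have := DFunLike.congr_fun h (vert k 0)
    rw [standardAut_vert, standardAut_vert, vert_eq_vert] at this
    simpa using this
  refine ⟨by simpa using neg_mem h0, ?_⟩
  -- Up to translation, this neighbour goes to `ind {c}` or `ind {c}ᶜ`. The cardinalities 1 and `d`
  -- differ, so `e` and then `c` can be read off.
  have h1 := DFunLike.congr_fun h (vert k (ind {0}))
  have key : ∀ (u : Fin (d + 1) → ℤ) (b : Fin (d + 1)) (s : Bool),
      standardAut k u b s (vert k (ind {0})) =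
        vert k (u + ind (if s then {b}ᶜ else {b})) := by
    intro u b s
    rw [standardAut_vert, add_comm _ u]
    cases s
    · congr 2
      ext j
      simp [ind, sub_eq_zero]
    · rw [vert_eq_vert]
      convert const_mem_periods (d := d) (k := k) 1 using 1
      ext j
      by_cases hj : j = b <;> simp [ind, sub_eq_zero, hj]
  rw [key, key] at h1
  have h2 : vert k (v' + ind (if e' then {c'}ᶜ else {c'})) =
      vert k (v + ind (if e' then {c'}ᶜ else {c'})) := by
    rw [vert_eq_vert]
    simpa using neg_mem h0
  rw [h2] at h1
  have hcard : ∀ b : Fin (d + 1), ({b}ᶜ : Finset (Fin (d + 1))).card = d := fun b => by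
    simp [Finset.card_compl]
  have hne : ∀ (b : Fin (d + 1)) (s : Bool),
      (if s then {b}ᶜ else {b} : Finset (Fin (d + 1))) ≠ ∅ := by
    intro b s h
    have := congrArg Finset.card h
    cases s
    · simp at this
    · rw [if_pos rfl, hcard, Finset.card_empty] at this
      omega
  rcases eq_of_vert_add_ind_eq hk h1 with h3 | ⟨h3, -⟩ | ⟨-, h3⟩
  · have h4 := congrArg Finset.card h3
    cases e <;> cases e'
    · simpa using h3
    · simp only [Bool.false_eq_true, if_false, if_true, hcard, Finset.card_singleton] at h4
      omega
    · simp only [Bool.false_eq_true, if_false, if_true, hcard, Finset.card_singleton] at h4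
      omega
    · simpa using h3
  · exact absurd h3 (hne _ _)
  · exact absurd h3 (hne _ _)

theorem card_torusAut (hd : 2 ≤ d) (hk : 1 ≤ k) :
    Nat.card (TorusAut (fun _ : Fin (d + 1) => k)) =
      Nat.card ((Fin (d + 1) → ℤ) ⧸ periods d k) * ((d + 1) * 2) := by
  let F : ((Fin (d + 1) → ℤ) ⧸ periods d k) × Fin (d + 1) × Bool →
      TorusAut (fun _ : Fin (d + 1) => k) := fun x => standardAut k x.1.out x.2.1 x.2.2
  have hF : Function.Bijective F := by
    constructor
    · rintro ⟨q, c, e⟩ ⟨q', c', e'⟩ h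
      obtain ⟨h1, rfl, rfl⟩ := eq_of_standardAut_eq hd hk h
      have h2 := (Submodule.Quotient.eq (periods d k)).2 h1
      rw [← Submodule.Quotient.mk_out q, ← Submodule.Quotient.mk_out q', h2]
    · intro f
      obtain ⟨v, hv⟩ := exists_map_vert f 0
      let q : (Fin (d + 1) → ℤ) ⧸ periods d k := Submodule.Quotient.mk v
      have hq : f (vert k 0) = vert k q.out := by
        rw [hv, vert_eq_vert, ← Submodule.Quotient.eq]
        exact Submodule.Quotient.mk_out q
      obtain ⟨c, e, h⟩ := exists_eq_standardAut hd hk f hq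
      exact ⟨(q, c, e), h.symm⟩
  rw [← Nat.card_congr (Equiv.ofBijective F hF), Nat.card_prod, Nat.card_prod]
  simp

end HeawoodTorus

theorem mainTheorem8 (d : ℕ) (hd : 2 ≤ d) (k : ℕ) (hk : 1 ≤ k) :
    Subgroup.closure
        (HeawoodTorus.translations (fun _ : Fin (d + 1) => k) ∪
          {HeawoodTorus.signReversal (fun _ : Fin (d + 1) => k),
            HeawoodTorus.cyclicShift d k}) =
      (⊤ : Subgroup (HeawoodTorus.TorusAut (fun _ : Fin (d + 1) => k))) ∧
    (Nat.card (HeawoodTorus.TorusAut (fun _ : Fin (d + 1) => k)) : ℤ) =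
      2 * ((d : ℤ) + 1) * (HeawoodTorus.M (fun _ : Fin (d + 1) => k)).det := by
  constructor
  · rw [eq_top_iff]
    intro f _
    obtain ⟨v, hv⟩ := HeawoodTorus.exists_map_vert f 0
    obtain ⟨c, e, rfl⟩ := HeawoodTorus.exists_eq_standardAut hd hk f hv
    rw [HeawoodTorus.standardAut]
    refine mul_mem (Subgroup.subset_closure ?_)
      (mul_mem (pow_mem (Subgroup.subset_closure ?_) _) ?_)
    · exact Or.inl ⟨_, rfl⟩
    · exact Or.inr (Or.inr rfl)
    split_ifs
    · refine Subgroup.subset_closure ?_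
      exact Or.inr (Or.inl rfl)
    · exact one_mem _
  · rw [HeawoodTorus.card_torusAut hd hk, ← HeawoodTorus.card_quotient_periods]
    push_cast
    ring
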